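/- Digraphs are finite and may have multiple arcs but no loops. An $r$-arborescence is a digraph whose underlying undirected graph is a tree and in which, for every vertex $u$, there is exactly one directed path from $r$ to $u$; $r$ is its root. A branching $B$ of a digraph $D$ is a spanning subdigraph of $D$ each component of which is an arborescence; its root set $R(B)$ consists of the roots of its components, and its size is its number of arcs. A decomposition of $D$ into $k$ branchings is a family of $k$ pairwise arc-disjoint branchings $B_1,\dots,B_k$ of $D$ (possibly without arcs) that together contain all arcs of $D$. Let $\Delta^-(D)$ be the maximum in-degree of $D$, and let $$\gamma(D)=\max_{H}\frac{|E(H)|}{|V(H)|-1}$$ be its fractional arboricity, where $H$ runs over the subgraphs of the underlying graph of $D$ with $|V(H)|\ge 2$ ($\gamma(D)=0$ if there is none). Let $D=(V,A)$ be a digraph and $k\ge 1$ an integer. (1) If $A$ can be covered by $k$ branchings, then $A$ can be covered by $k$ branchings each of size $\lfloor |A|/k\rfloor$ or $\lceil |A|/k\rceil$. (2) (Equivalent form.) If $\Delta^-(D)\le k$ and $\gamma(D)\le k$, and $c=k|V|-|A|$, then $D$ can be decomposed into $k$ branchings $B_1,\dots,B_k$ such that, for each $i$, $|R(B_i)|=\lfloor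 c/k\rfloor$ or $|R(B_i)|=\lceil c/k\rceil$. -/

import Mathlib

/-- A loopless digraph with vertex set `V` and arc set `E`; multiple arcs are allowed. -/
structure MultiDigraph (V : Type*) (E : Type*) where
  /-- the tail of an arc -/
  tail : E → V
  /-- the head of an arc -/
  head : E → V
  /-- there are no loops -/
  tail_ne_head : ∀ e, tail e ≠ head e

namespace MultiDigraph

variable {V : Type*} {E : Type*}

/-- A subdigraph (not necessarily spanning, not necessarily induced): a set of vertices and a set
of arcs whose ends are among these vertices. -/
@[ext] structure Subdigraph (D : MultiDigraph V E) where
  /-- the vertices -/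
  verts : Set V
  /-- the arcs -/
  arcs : Set E
  /-- tails of arcs are vertices -/
  tail_mem : ∀ e ∈ arcs, D.tail e ∈ verts
  /-- heads of arcs are vertices -/
  head_mem : ∀ e ∈ arcs, D.head e ∈ verts

/-- The first vertex of a traversal of an arc. The pair `(e, true)` stands for the arc `e`
traversed forwards, from tail to head, and `(e, false)` for `e` traversed backwards. -/
def source (D : MultiDigraph V E) (d : E × Bool) : V :=
  if d.2 then D.tail d.1 else D.head d.1

/-- The last vertex of a traversal of an arc. -/
def target (D : MultiDigraph V E) (d : E × Bool) : V :=
  if d.2 then D.head d.1 else D.tail d.1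

namespace Subdigraph

variable {D : MultiDigraph V E}

/-- `H.IsWalk u l v`: the list `l` of traversals of arcs of `H` is a walk from `u` to `v` in the
underlying undirected graph of `H`. -/
def IsWalk (H : D.Subdigraph) : V → List (E × Bool) → V → Prop
  | u, [], v => u ∈ H.verts ∧ u = v
  | u, d :: l, v => d.1 ∈ H.arcs ∧ D.source d = u ∧ H.IsWalk (D.target d) l v

/-- A directed path of `H` from `u` to `v`: a walk that traverses every arc forwards and visits no
vertex twice. -/
def IsDirectedPath (H : D.Subdigraph) (u : V) (l : List (E × Bool)) (v : V) : Prop :=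
  H.IsWalk u l v ∧ (∀ d ∈ l, d.2 = true) ∧ (u :: l.map D.target).Nodup

/-- `l` traverses a cycle through `u` of the underlying undirected graph of `H`: a closed walk
of positive length without repeated arcs and without repeated vertices (apart from its first vertex
being its last one). Two parallel or antiparallel arcs form a cycle of length two. -/
def IsCycle (H : D.Subdigraph) (u : V) (l : List (E × Bool)) : Prop :=
  H.IsWalk u l u ∧ l ≠ [] ∧ (l.map Prod.fst).Nodup ∧ (l.map D.target).Nodup

/-- Two vertices are joined by a walk in the underlying undirected graph of `H`. -/
def Reachable (H : D.Subdigraph) (u v : V) : Prop :=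
  ∃ l, H.IsWalk u l v

/-- The underlying undirected graph of `H` is a tree: it is non-empty, connected and acyclic. -/
def IsTree (H : D.Subdigraph) : Prop :=
  H.verts.Nonempty ∧ (∀ u ∈ H.verts, ∀ v ∈ H.verts, H.Reachable u v) ∧ ∀ u l, ¬ H.IsCycle u l

/-- `H` is an `r`-arborescence. -/
def IsArborescence (H : D.Subdigraph) (r : V) : Prop :=
  H.IsTree ∧ r ∈ H.verts ∧ ∀ u ∈ H.verts, ∃! l, H.IsDirectedPath r l u

/-- The (weakly) connected component of `H` that contains the vertex `v`. -/
def component (H : D.Subdigraph) (v : V) : D.Subdigraph where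
  verts := {u | u ∈ H.verts ∧ H.Reachable v u}
  arcs := {e | e ∈ H.arcs ∧ H.Reachable v (D.tail e) ∧ H.Reachable v (D.head e)}
  tail_mem := fun e he => ⟨H.tail_mem e he.1, he.2.1⟩
  head_mem := fun e he => ⟨H.head_mem e he.1, he.2.2⟩

/-- A branching: a spanning subdigraph each component of which is an arborescence. -/
def IsBranching (B : D.Subdigraph) : Prop :=
  B.verts = Set.univ ∧ ∀ v ∈ B.verts, ∃ r, (B.component v).IsArborescence r

/-- The root set: all roots of the components. -/
def rootSet (B : D.Subdigraph) : Set V :=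
  {r | ∃ v ∈ B.verts, (B.component v).IsArborescence r}

/-- The size of a subdigraph is its number of arcs. -/
noncomputable def size (B : D.Subdigraph) : ℕ := B.arcs.ncard

end Subdigraph

/-- The arcs are covered by the `k` branchings `B 0, …, B (k - 1)` (which may share arcs). -/
def IsBranchingCover (D : MultiDigraph V E) {k : ℕ} (B : Fin k → D.Subdigraph) : Prop :=
  (∀ i, (B i).IsBranching) ∧ ∀ e : E, ∃ i, e ∈ (B i).arcs

/-- `D` is decomposed into the `k` branchings `B 0, …, B (k - 1)`: they are pairwise arc-disjoint
and cover all arcs. -/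
def IsBranchingDecomposition (D : MultiDigraph V E) {k : ℕ} (B : Fin k → D.Subdigraph) : Prop :=
  D.IsBranchingCover B ∧ ∀ i j, i ≠ j → Disjoint (B i).arcs (B j).arcs

/-- The in-degree of a vertex. -/
noncomputable def inDegree (D : MultiDigraph V E) (v : V) : ℕ := {e | D.head e = v}.ncard

/-- The maximum in-degree (`0` if there is no vertex). -/
noncomputable def maxInDegree (D : MultiDigraph V E) : ℕ := ⨆ v, D.inDegree v

/-- The fractional arboricity: the maximum of `|E(H)| / (|V(H)| - 1)` over all subgraphs `H` with
at least two vertices (`0` if there are fewer than two vertices). -/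
noncomputable def fractionalArboricity (D : MultiDigraph V E) : ℝ :=
  sSup {q | ∃ H : D.Subdigraph, 2 ≤ H.verts.ncard ∧
    q = (H.arcs.ncard : ℝ) / ((H.verts.ncard : ℝ) - 1)}

end MultiDigraph

/-! ### Edmonds' disjoint branchings theorem -/

section Edmonds

open Finset

variable {W F ι : Type*}

/-! Branchings are handled through their arc sets, the diforests. Since subsets of diforests are
diforests, a cover by branchings amounts to a colouring of the arcs with diforest classes; under the
bounds on in-degree and arboricity, such a colouring comes from Edmonds' theorem
(`exists_diforest_coloring`).

Balancing (`exists_balanced_coloring`): take a colouring minimising the sum of squares of the class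
sizes. If `B` and `C` are classes with `#B + 2 ≤ #C`, then `B` has more roots than `C`, and
`exists_root_to_move` finds a root `v` of `B`, not of `C`, for which Edmonds' condition still holds
once `v` becomes a root of `C` instead. Edmonds' theorem with two root sets then repartitions `B ∪
C`, moving one unit of size from `C` to `B` (`exists_exchange`), against minimality. As roots plus
arcs of a branching number `|V|`, balanced sizes and balanced root counts are the same thing. -/

/-- `B` is the arc set of a branching: no two arcs of `B` share their head, and along each arc of
`B` a suitable rank function increases. -/
def IsDiforest (t h : F → W) (B : Set F) : Prop :=
  Set.InjOn h B ∧ ∃ rank : W → ℕ, ∀ e ∈ B, rank (t e) < rank (h e)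

theorem IsDiforest.mono {t h : F → W} {B C : Set F} (hC : IsDiforest t h C) (hBC : B ⊆ C) :
    IsDiforest t h B :=
  ⟨hC.1.mono hBC, hC.2.imp fun _ hr e he => hr e (hBC he)⟩

/-- The arcs of `A` that enter the vertex set `U`. -/
def enteringArcs [DecidableEq W] (t h : F → W) (A : Finset F) (U : Finset W) : Finset F :=
  A.filter fun e => h e ∈ U ∧ t e ∉ U

/-- The indices in `I` whose set is disjoint from `U`. -/
def missedIndices [DecidableEq W] (S : ι → Finset W) (I : Finset ι) (U : Finset W) : Finset ι :=
  I.filter fun j => Disjoint (S j) U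

variable [DecidableEq W]

/-- Submodularity of the cut function, checked arc by arc. -/
theorem card_enteringArcs_inter_add_union (t h : F → W) (A : Finset F) (U X : Finset W) :
    #(enteringArcs t h A (U ∩ X)) + #(enteringArcs t h A (U ∪ X)) ≤
      #(enteringArcs t h A U) + #(enteringArcs t h A X) := by
  simp only [enteringArcs, card_filter, ← sum_add_distrib]
  refine sum_le_sum fun e _ => ?_
  by_cases h1 : h e ∈ U <;> by_cases h2 : h e ∈ X <;> by_cases h3 : t e ∈ U <;>
    by_cases h4 : t e ∈ X <;> simp [h1, h2, h3, h4]

/-- The matching supermodularity: missing either set implies missing the intersection, and missing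
both implies missing the union. -/
theorem card_missedIndices_add_le (S : ι → Finset W) (I : Finset ι) (U X : Finset W) :
    #(missedIndices S I U) + #(missedIndices S I X) ≤
      #(missedIndices S I (U ∩ X)) + #(missedIndices S I (U ∪ X)) := by
  simp only [missedIndices, card_filter, ← sum_add_distrib]
  refine sum_le_sum fun j _ => ?_
  have hU : Disjoint (S j) U → Disjoint (S j) (U ∩ X) := fun H => H.mono_right inter_subset_left
  have hX : Disjoint (S j) X → Disjoint (S j) (U ∩ X) := fun H => H.mono_right inter_subset_right
  by_cases h1 : Disjoint (S j) U <;> by_cases h2 : Disjoint (S j) X <;>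
    simp [h1, h2, hU, hX, disjoint_union_right]

theorem card_missedIndices_anti (S : ι → Finset W) (I : Finset ι) {U X : Finset W} (hUX : U ⊆ X) :
    #(missedIndices S I X) ≤ #(missedIndices S I U) :=
  card_le_card (monotone_filter_right _ fun _ _ H => H.mono_right hUX)

variable [Fintype W] [DecidableEq F]

theorem IsDiforest.insert_first {t h : F → W} {B : Finset F} {S : Finset W} {e : F}
    (hB : IsDiforest t h (B : Set F)) (himg : B.image h = univ \ insert (h e) S)
    (ht : t e ∈ S) (hh : h e ∉ S) :
    IsDiforest t h (insert e B : Finset F) ∧ (insert e B).image h = univ \ S := by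
  obtain ⟨hinj, rank, hrank⟩ := hB
  have hnot : ∀ f ∈ B, h f ≠ h e ∧ h f ∉ S := by
    intro f hf
    have := mem_image_of_mem h hf
    rw [himg] at this
    simpa using this
  -- No arc of `B` has its head in `S` or at `h e`, so these vertices may be given the lowest ranks.
  refine ⟨⟨?_, fun v => if v ∈ S then 0 else if v = h e then 1 else rank v + 2, ?_⟩, ?_⟩
  · rw [coe_insert, Set.injOn_insert fun he => (hnot e he).1 rfl]
    exact ⟨hinj, fun ⟨f, hf, hfe⟩ => (hnot f hf).1 hfe⟩
  · intro f hf
    rw [coe_insert, Set.mem_insert_iff] at hf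
    rcases hf with rfl | hf
    · simp [ht, hh]
    · have h1 := hnot f hf
      have h2 := hrank f hf
      simp only [h1.1, h1.2, if_false]
      split_ifs <;> omega
  · rw [image_insert, himg]
    ext v
    simp only [mem_insert, mem_sdiff, mem_univ, true_and, not_or]
    constructor
    · rintro (rfl | H)
      · exact hh
      · exact H.2
    · intro H
      by_cases hv : v = h e
      · exact Or.inl hv
      · exact Or.inr ⟨hv, H⟩

variable [Fintype ι] [DecidableEq ι]

/-- The augmenting step of Lovász' proof of Edmonds' theorem. -/
theorem exists_arc_augmenting (t h : F → W) (A : Finset F) (S : ι → Finset W)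
    (hS : ∀ U : Finset W, U.Nonempty → #(missedIndices S univ U) ≤ #(enteringArcs t h A U))
    (i : ι) (hi : S i ≠ univ) :
    ∃ e ∈ A, t e ∈ S i ∧ h e ∉ S i ∧ ∀ U : Finset W, U.Nonempty →
      #(missedIndices (Function.update S i (insert (h e) (S i))) univ U) ≤
        #(enteringArcs t h (A.erase e) U) := by
  have hle : ∀ U, #(missedIndices S (univ.erase i) U) ≤ #(missedIndices S univ U) := fun U =>
    card_le_card (filter_subset_filter _ (erase_subset _ _))
  obtain ⟨x, hx⟩ : ∃ x, x ∉ S i := by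
    by_contra! H
    exact hi (eq_univ_iff_forall.2 H)
  -- The dangerous sets: the indices other than `i` already need every entering arc. The new arc is
  -- sought inside a smallest one.
  let T : Finset (Finset W) := univ.filter fun U =>
    #(enteringArcs t h A U) ≤ #(missedIndices S (univ.erase i) U) ∧ (U \ S i).Nonempty
  have hT : T.Nonempty := by
    refine ⟨univ, ?_⟩
    simp only [T, mem_filter, mem_univ, true_and]
    refine ⟨?_, x, by simp [hx]⟩
    simp [enteringArcs]
  obtain ⟨U, hUT, hUmin⟩ := exists_min_image T card hT
  simp only [T, mem_filter, mem_univ, true_and] at hUT hUmin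
  obtain ⟨hU, hUne⟩ := hUT
  -- The index `i` itself misses `U \ S i`. Hence more arcs enter `U \ S i` than `U`, and one of
  -- them starts in `U ∩ S i`.
  have hlt : #(missedIndices S (univ.erase i) (U \ S i)) + 1 ≤
      #(missedIndices S univ (U \ S i)) := by
    refine Nat.succ_le_of_lt (card_lt_card ?_)
    refine (ssubset_iff_of_subset (filter_subset_filter _ (erase_subset _ _))).2 ⟨i, ?_, ?_⟩
    · simp [disjoint_sdiff]
    · simp
  have hcard : #(enteringArcs t h A U) < #(enteringArcs t h A (U \ S i)) := by
    have h1 := hS _ hUne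
    have h2 := card_missedIndices_anti S (univ.erase i) (sdiff_subset : U \ S i ⊆ U)
    omega
  obtain ⟨e, he, he'⟩ := exists_mem_notMem_of_card_lt_card hcard
  simp only [enteringArcs, mem_filter, mem_sdiff, not_and, not_not] at he he'
  obtain ⟨heA, ⟨hhU, hhS⟩, htU⟩ := he
  have htU' := he' heA hhU
  have htS : t e ∈ S i := htU htU'
  refine ⟨e, heA, htS, hhS, fun X hX => ?_⟩
  have hmono : #(missedIndices (Function.update S i (insert (h e) (S i))) univ X) ≤
      #(missedIndices S univ X) := by
    refine card_le_card (monotone_filter_right _ fun j _ H => ?_)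
    by_cases hj : j = i
    · subst hj
      simp only [Function.update_self, disjoint_insert_left] at H
      exact H.2
    · simpa [Function.update_of_ne hj] using H
  by_cases hent : h e ∈ X ∧ t e ∉ X
  · have hmiss : missedIndices (Function.update S i (insert (h e) (S i))) univ X =
        missedIndices S (univ.erase i) X := by
      ext j
      simp only [missedIndices, mem_filter, mem_univ, true_and, mem_erase, and_true]
      by_cases hj : j = i
      · subst hj
        simp [hent.1]
      · simp [hj]
    have herase : enteringArcs t h (A.erase e) X = (enteringArcs t h A X).erase e := by
      ext f; simp [enteringArcs, and_assoc]
    have hemem : e ∈ enteringArcs t h A X := by simp [enteringArcs, heA, hent]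
    rw [hmiss, herase, card_erase_of_mem hemem]
    -- A violating `X` is itself tight for the other indices; uncrossing makes `U ∩ X` dangerous,
    -- yet it omits `t e` and so is smaller than `U`.
    by_contra! hbad
    have hX' : #(enteringArcs t h A X) ≤ #(missedIndices S (univ.erase i) X) := by omega
    have h1 := card_enteringArcs_inter_add_union t h A U X
    have h2 := card_missedIndices_add_le S (univ.erase i) U X
    have h3 := (hle (U ∪ X)).trans (hS (U ∪ X) (hX.mono subset_union_right))
    have h4 := hUmin (U ∩ X) ⟨by omega, h e, by simp [hhU, hent.1, hhS]⟩
    have h5 : #(U ∩ X) < #U :=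
      card_lt_card ((ssubset_iff_of_subset inter_subset_left).2 ⟨t e, htU', by simp [hent.2]⟩)
    omega
  · have herase : enteringArcs t h (A.erase e) X = enteringArcs t h A X := by
      ext f
      simp only [enteringArcs, mem_filter, mem_erase]
      constructor
      · exact fun H => ⟨H.1.2, H.2⟩
      · exact fun H => ⟨⟨fun hf => hent (hf ▸ H.2), H.1⟩, H.2⟩
    rw [herase]
    exact hmono.trans (hS X hX)

/-- **Edmonds' disjoint branchings theorem.** -/
theorem exists_disjoint_diforests (t h : F → W) (A : Finset F) (S : ι → Finset W)
    (hS : ∀ U : Finset W, U.Nonempty → #(missedIndices S univ U) ≤ #(enteringArcs t h A U)) :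
    ∃ B : ι → Finset F, (∀ i, B i ⊆ A) ∧ (∀ i j, i ≠ j → Disjoint (B i) (B j)) ∧
      ∀ i, IsDiforest t h (B i : Set F) ∧ (B i).image h = univ \ S i := by
  induction hn : ∑ i, #(univ \ S i) using Nat.strong_induction_on generalizing A S with
  | _ n ih =>
  by_cases hall : ∀ i, S i = univ
  · refine ⟨fun _ => ∅, by simp, by simp, fun i => ⟨⟨by simp, fun _ => 0, by simp⟩, ?_⟩⟩
    simp [hall i]
  push Not at hall
  obtain ⟨i, hi⟩ := hall
  obtain ⟨e, heA, ht, hh, hS'⟩ := exists_arc_augmenting t h A S hS i hi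
  obtain ⟨B, hBA, hdisj, hB⟩ := ih _ (by
    rw [← hn]
    refine sum_lt_sum (fun j _ => ?_) ⟨i, mem_univ i, ?_⟩
    · refine card_le_card (sdiff_subset_sdiff subset_rfl ?_)
      by_cases hj : j = i
      · subst hj; simp
      · simp [hj]
    · refine card_lt_card ((ssubset_iff_of_subset ?_).2 ⟨h e, by simpa using hh, by simp⟩)
      exact sdiff_subset_sdiff subset_rfl (by simp)) (A.erase e) _ hS' rfl
  have heB : ∀ j, e ∉ B j := fun j H => by simpa using hBA j H
  have hi' := hB i
  rw [Function.update_self] at hi'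
  refine ⟨Function.update B i (insert e (B i)), fun j => ?_, fun j l hjl => ?_, fun j => ?_⟩
  · by_cases hj : j = i
    · subst hj
      simpa [insert_subset_iff, heA] using (hBA j).trans (erase_subset _ _)
    · simpa [hj] using (hBA j).trans (erase_subset _ _)
  · by_cases hj : j = i
    · subst hj
      simp [hjl.symm, heB, hdisj j l hjl]
    · by_cases hl : l = i
      · subst hl
        simp [hjl, heB, hdisj j l hjl]
      · simp [hj, hl, hdisj j l hjl]
  · by_cases hj : j = i
    · subst hj
      rw [Function.update_self]
      exact hi'.1.insert_first hi'.2 ht hh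
    · have := hB j
      rw [Function.update_of_ne hj] at this
      rwa [Function.update_of_ne hj]

end Edmonds

/-! ### Exchanging roots between two diforests, and balancing -/

section Balancing

open Finset

variable {W F ι : Type*} [DecidableEq W]

/-- The arc of `B` into a vertex of least rank in `U` must come from outside `U`. -/
theorem IsDiforest.exists_entering {t h : F → W} {B : Finset F} (hB : IsDiforest t h (B : Set F))
    {U : Finset W} (hU : U.Nonempty) (hBU : U ⊆ B.image h) : ∃ e ∈ B, h e ∈ U ∧ t e ∉ U := by
  obtain ⟨rank, hrank⟩ := hB.2
  obtain ⟨v, hv, hmin⟩ := exists_min_image U rank hU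
  obtain ⟨e, he, rfl⟩ := mem_image.1 (hBU hv)
  exact ⟨e, he, hv, fun H => (hmin _ H).not_gt (hrank e he)⟩

theorem IsDiforest.card_image {t h : F → W} {B : Finset F} (hB : IsDiforest t h (B : Set F)) :
    #(B.image h) = #B :=
  card_image_of_injOn hB.1

variable [Fintype W] [DecidableEq F]

/-- A root of the smaller of two disjoint diforests can be made a root of the other one. -/
theorem exists_root_to_move {t h : F → W} {B C : Finset F}
    (hB : IsDiforest t h (B : Set F)) (hC : IsDiforest t h (C : Set F)) (hcard : #B < #C) :
    ∃ v, v ∉ B.image h ∧ v ∈ C.image h ∧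
      ∀ U : Finset W, v ∈ U → U ⊆ insert v (B.image h) →
        (enteringArcs t h (B ∪ C) U).Nonempty := by
  by_contra! H
  -- Each candidate `v` is blocked by a set `U` that no arc enters. Such a `U` contains a root `w`
  -- of `C`, since otherwise `C` would enter it.
  have key : ∀ v ∈ C.image h \ B.image h, ∃ U : Finset W, v ∈ U ∧ U ⊆ insert v (B.image h) ∧
      enteringArcs t h (B ∪ C) U = ∅ ∧ ∃ w ∈ U, w ∈ B.image h \ C.image h := by
    intro v hv
    rw [mem_sdiff] at hv
    obtain ⟨U, hvU, hU, hent⟩ := H v hv.2 hv.1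
    refine ⟨U, hvU, hU, hent, ?_⟩
    have : ¬ U ⊆ C.image h := by
      intro hUC
      obtain ⟨e, he, he'⟩ := hC.exists_entering ⟨v, hvU⟩ hUC
      have : e ∈ enteringArcs t h (B ∪ C) U := by simp [enteringArcs, he, he']
      simp [hent] at this
    obtain ⟨w, hwU, hw⟩ := not_subset.1 this
    refine ⟨w, hwU, mem_sdiff.2 ⟨(mem_insert.1 (hU hwU)).resolve_left ?_, hw⟩⟩
    rintro rfl
    exact hw hv.1
  choose! U hvU hU hent w hwU hw using key
  -- If two blocking sets shared `w`, their intersection would be nonempty without roots of `B`, so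
  -- an arc of `B` would enter it and hence one of the two sets.
  have hinj : Set.InjOn w (C.image h \ B.image h : Finset W) := by
    intro v hv v' hv' heq
    by_contra hne
    rw [mem_coe] at hv hv'
    have hsub : U v ∩ U v' ⊆ B.image h := by
      intro x hx
      rw [mem_inter] at hx
      rcases mem_insert.1 (hU v hv hx.1) with rfl | h1
      · exact (mem_insert.1 (hU v' hv' hx.2)).resolve_left hne
      · exact h1
    obtain ⟨e, he, he'⟩ := hB.exists_entering
      ⟨w v, mem_inter.2 ⟨hwU v hv, heq ▸ hwU v' hv'⟩⟩ hsub
    have h1 : e ∉ enteringArcs t h (B ∪ C) (U v) := by simp [hent v hv]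
    have h2 : e ∉ enteringArcs t h (B ∪ C) (U v') := by simp [hent v' hv']
    simp only [enteringArcs, mem_filter, mem_union, he, true_or, true_and, not_and, not_not,
      mem_inter] at h1 h2 he'
    exact he'.2 (h1 he'.1.1) (h2 he'.1.2)
  have h1 : #(C.image h \ B.image h) ≤ #(B.image h \ C.image h) :=
    card_le_card_of_injOn w (fun v hv => hw v hv) hinj
  have h2 := card_sdiff_add_card_inter (C.image h) (B.image h)
  have h3 := card_sdiff_add_card_inter (B.image h) (C.image h)
  rw [inter_comm] at h3
  rw [hB.card_image] at h3
  rw [hC.card_image] at h2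
  omega

theorem exists_exchange {t h : F → W} {B C : Finset F} (hBC : Disjoint B C)
    (hB : IsDiforest t h (B : Set F)) (hC : IsDiforest t h (C : Set F)) (hcard : #B < #C) :
    ∃ B' C' : Finset F, Disjoint B' C' ∧ B' ∪ C' = B ∪ C ∧ IsDiforest t h (B' : Set F) ∧
      IsDiforest t h (C' : Set F) ∧ #B' = #B + 1 ∧ #C' + 1 = #C := by
  obtain ⟨v, hvB, hvC, hv⟩ := exists_root_to_move hB hC hcard
  -- Edmonds' condition for two root sets, given as complements of the desired head sets. Only sets
  -- containing `v` need the choice of `v`; for the others `B` and `C` supply the entering arcs.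
  have hcond : ∀ U : Finset W, U.Nonempty →
      #(missedIndices (fun b => univ \ bif b then insert v (B.image h) else (C.image h).erase v)
        univ U) ≤ #(enteringArcs t h (B ∪ C) U) := by
    intro U hU
    have hdis : ∀ X : Finset W, Disjoint (univ \ X) U ↔ U ⊆ X := by
      intro X
      rw [disjoint_left, subset_iff]
      simp only [mem_sdiff, mem_univ, true_and]
      exact forall_congr' fun x => not_imp_not
    have hBU : U ⊆ B.image h → ∃ e ∈ B, e ∈ enteringArcs t h (B ∪ C) U := fun H => by
      obtain ⟨e, he, he'⟩ := hB.exists_entering hU H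
      exact ⟨e, he, by simp [enteringArcs, he, he']⟩
    have hCU : U ⊆ C.image h → ∃ e ∈ C, e ∈ enteringArcs t h (B ∪ C) U := fun H => by
      obtain ⟨e, he, he'⟩ := hC.exists_entering hU H
      exact ⟨e, he, by simp [enteringArcs, he, he']⟩
    have hsum : #(missedIndices (fun b => univ \ bif b then insert v (B.image h) else
        (C.image h).erase v) univ U) = (if U ⊆ insert v (B.image h) then 1 else 0) +
          (if U ⊆ (C.image h).erase v then 1 else 0) := by
      rw [missedIndices, card_filter, Fintype.sum_bool]
      simp only [hdis, cond_true, cond_false]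
    rw [hsum]
    by_cases hvU : v ∈ U
    · rw [if_neg (show ¬ U ⊆ (C.image h).erase v from fun H => by simpa using H hvU)]
      split_ifs with h1
      · exact card_pos.2 (hv U hvU h1)
      · exact Nat.zero_le _
    · have herase : U ⊆ (C.image h).erase v ↔ U ⊆ C.image h := by
        rw [subset_erase]; exact and_iff_left hvU
      simp only [herase, subset_insert_iff_of_notMem hvU]
      split_ifs with h1 h2 h2
      · obtain ⟨e, he, he'⟩ := hBU h1
        obtain ⟨f, hf, hf'⟩ := hCU h2
        have hne : e ≠ f := by
          rintro rfl
          exact disjoint_left.1 hBC he hf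
        exact one_lt_card.2 ⟨e, he', f, hf', hne⟩
      · obtain ⟨e, he, he'⟩ := hBU h1
        exact card_pos.2 ⟨e, he'⟩
      · obtain ⟨e, he, he'⟩ := hCU h2
        exact card_pos.2 ⟨e, he'⟩
      · exact Nat.zero_le _
  obtain ⟨X, hX, hdisj, hXB⟩ := exists_disjoint_diforests t h (B ∪ C) _ hcond
  have h1 := hXB true
  have h2 := hXB false
  simp only [cond_true, cond_false, sdiff_sdiff_right_self, inf_eq_inter, univ_inter] at h1 h2
  have hc1 : #(X true) = #B + 1 := by
    rw [← h1.1.card_image, h1.2, card_insert_of_notMem hvB, hB.card_image]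
  have hc2 : #(X false) + 1 = #C := by
    rw [← h2.1.card_image, h2.2, card_erase_add_one hvC, hC.card_image]
  have hd := hdisj true false (by simp)
  refine ⟨X true, X false, hd, ?_, h1.1, h2.1, hc1, hc2⟩
  -- The new sizes have the same sum, so no arc is left over.
  refine eq_of_subset_of_card_le (union_subset (hX _) (hX _)) ?_
  rw [card_union_of_disjoint hd, card_union_of_disjoint hBC]
  omega

/-- A partition of the arcs into diforests can be made balanced. -/
theorem exists_balanced_coloring [Fintype F] [Fintype ι] [DecidableEq ι] {t h : F → W} (f : F → ι)
    (hf : ∀ i, IsDiforest t h {e | f e = i}) :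
    ∃ g : F → ι, (∀ i, IsDiforest t h {e | g e = i}) ∧
      ∀ i j, #{e | g e = i} ≤ #{e | g e = j} + 1 := by
  have : Nonempty {f : F → ι // ∀ i, IsDiforest t h {e | f e = i}} := ⟨⟨f, hf⟩⟩
  obtain ⟨⟨g, hg⟩, hmin⟩ := Finite.exists_min
    fun f : {f : F → ι // ∀ i, IsDiforest t h {e | f e = i}} => ∑ i, #{e | f.1 e = i} ^ 2
  refine ⟨g, hg, fun i j => ?_⟩
  by_contra! hij
  have hne : i ≠ j := by rintro rfl; omega
  have hdisj : Disjoint (univ.filter (g · = j)) (univ.filter (g · = i)) := by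
    rw [disjoint_left]
    intro e he he'
    simp only [mem_filter, mem_univ, true_and] at he he'
    exact hne (he'.symm.trans he)
  obtain ⟨B, C, hBC, hunion, hB, hC, hcB, hcC⟩ :=
    exists_exchange hdisj (by simpa using hg j) (by simpa using hg i) (by omega)
  have hmem : ∀ e, e ∈ B ∨ e ∈ C ↔ g e = j ∨ g e = i := by
    intro e
    simpa using congrArg (e ∈ ·) hunion
  let g' : F → ι := fun e => if e ∈ B then j else if e ∈ C then i else g e
  have hj' : ∀ e, g' e = j ↔ e ∈ B := by
    intro e
    have := hmem e
    by_cases h1 : e ∈ B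
    · simp [g', h1]
    · by_cases h2 : e ∈ C
      · simp [g', h1, h2, hne]
      · have h3 : ¬ g e = j := fun H => by simp [h1, h2, H] at this
        simp [g', h1, h2, h3]
  have hi' : ∀ e, g' e = i ↔ e ∈ C := by
    intro e
    have := hmem e
    by_cases h1 : e ∈ B
    · simp [g', h1, hne.symm, disjoint_left.1 hBC h1]
    · by_cases h2 : e ∈ C
      · simp [g', h1, h2]
      · have h3 : ¬ g e = i := fun H => by simp [h1, h2, H] at this
        simp [g', h1, h2, h3]
  have hl' : ∀ l, l ≠ i → l ≠ j → ∀ e, g' e = l ↔ g e = l := by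
    intro l hli hlj e
    have := hmem e
    by_cases h1 : e ∈ B
    · simp only [h1, true_or, true_iff] at this
      simp only [g', h1, if_true, hlj.symm, false_iff]
      rcases this with h | h <;> rw [h]
      exacts [hlj.symm, hli.symm]
    · by_cases h2 : e ∈ C
      · simp only [h2, or_true, true_iff] at this
        simp only [g', h1, h2, if_true, if_false, hli.symm, false_iff]
        rcases this with h | h <;> rw [h]
        exacts [hlj.symm, hli.symm]
      · simp [g', h1, h2]
  have hg' : ∀ l, IsDiforest t h {e | g' e = l} := by
    intro l
    by_cases hlj : l = j
    · subst hlj; simp only [hj']; exact hB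
    by_cases hli : l = i
    · subst hli; simp only [hi']; exact hC
    simpa only [hl' l hli hlj] using hg l
  have hlt := hmin ⟨g', hg'⟩
  simp only at hlt
  rw [← add_sum_erase _ _ (mem_univ i), ← add_sum_erase _ _ (mem_univ i),
    ← add_sum_erase _ _ (mem_erase.2 ⟨hne.symm, mem_univ j⟩),
    ← add_sum_erase _ _ (mem_erase.2 ⟨hne.symm, mem_univ j⟩)] at hlt
  have hsame : ∑ l ∈ (univ.erase i).erase j, #{e | g' e = l} ^ 2 =
      ∑ l ∈ (univ.erase i).erase j, #{e | g e = l} ^ 2 := by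
    refine sum_congr rfl fun l hl => ?_
    simp only [mem_erase, mem_univ, and_true] at hl
    simp only [hl' l hl.2 hl.1]
  rw [hsame] at hlt
  simp only [hj', hi', filter_mem_eq_inter, univ_inter] at hlt
  rw [hcB] at hlt
  rw [← hcC] at hlt hij
  -- Replacing sizes `b`, `c` with `b + 2 ≤ c` by `b + 1`, `c - 1` lowers the sum of squares.
  nlinarith

end Balancing

/-! ### Walks and components; branchings versus diforests -/

namespace MultiDigraph

variable {V E : Type*} {D : MultiDigraph V E}

@[simp] theorem target_true (D : MultiDigraph V E) (e : E) : D.target (e, true) = D.head e := rfl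

namespace Subdigraph

variable {H : D.Subdigraph} {u v w r : V} {l p q : List (E × Bool)} {d : E × Bool}

theorem source_mem (hd : d.1 ∈ H.arcs) : D.source d ∈ H.verts := by
  obtain ⟨e, _ | _⟩ := d
  exacts [H.head_mem e hd, H.tail_mem e hd]

theorem target_mem (hd : d.1 ∈ H.arcs) : D.target d ∈ H.verts := by
  obtain ⟨e, _ | _⟩ := d
  exacts [H.tail_mem e hd, H.head_mem e hd]

theorem IsWalk.left_mem (h : H.IsWalk u l v) : u ∈ H.verts := by
  cases l with
  | nil => exact h.1
  | cons d l => exact h.2.1 ▸ source_mem h.1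

theorem isWalk_append : H.IsWalk u (p ++ q) w ↔ ∃ v, H.IsWalk u p v ∧ H.IsWalk v q w := by
  induction p generalizing u with
  | nil =>
    constructor
    · exact fun h => ⟨u, ⟨h.left_mem, rfl⟩, h⟩
    · rintro ⟨v, ⟨-, rfl⟩, h⟩
      exact h
  | cons d p ih =>
    simp only [List.cons_append, IsWalk, ih]
    constructor
    · rintro ⟨h1, h2, v, h3, h4⟩
      exact ⟨v, ⟨h1, h2, h3⟩, h4⟩
    · rintro ⟨v, ⟨h1, h2, h3⟩, h4⟩
      exact ⟨h1, h2, v, h3, h4⟩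

theorem isWalk_concat :
    H.IsWalk u (p ++ [d]) w ↔ H.IsWalk u p (D.source d) ∧ d.1 ∈ H.arcs ∧ D.target d = w := by
  rw [isWalk_append]
  constructor
  · rintro ⟨v, h1, h2, h3, -, h4⟩
    exact ⟨h3 ▸ h1, h2, h4⟩
  · rintro ⟨h1, h2, h3⟩
    exact ⟨_, h1, h2, rfl, target_mem h2, h3⟩

theorem Reachable.trans (h : H.Reachable u v) (h' : H.Reachable v w) : H.Reachable u w :=
  ⟨_, isWalk_append.2 ⟨v, h.choose_spec, h'.choose_spec⟩⟩

theorem reachable_of_arc (hd : d.1 ∈ H.arcs) : H.Reachable (D.source d) (D.target d) :=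
  ⟨[d], hd, rfl, target_mem hd, rfl⟩

theorem Reachable.symm (h : H.Reachable u v) : H.Reachable v u := by
  obtain ⟨l, hl⟩ := h
  induction l generalizing u with
  | nil => exact ⟨[], hl.2 ▸ hl.1, hl.2.symm⟩
  | cons d l ih =>
    refine (ih hl.2.2).trans ?_
    rw [← hl.2.1]
    obtain ⟨e, b⟩ := d
    have := reachable_of_arc (d := (e, !b)) (H := H) hl.1
    cases b <;> exact this

theorem component_eq_of_reachable (h : H.Reachable u v) : H.component u = H.component v := by
  have key : ∀ x, H.Reachable u x ↔ H.Reachable v x := fun x => ⟨h.symm.trans, h.trans⟩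
  ext x <;> simp [component, key]

theorem isWalk_component_iff (h : H.Reachable r u) :
    (H.component r).IsWalk u l v ↔ H.IsWalk u l v := by
  induction l generalizing u with
  | nil =>
    simp only [IsWalk, component, Set.mem_ofPred_eq]
    tauto
  | cons d l ih =>
    obtain ⟨e, b⟩ := d
    constructor
    · rintro ⟨⟨h1, h2, h3⟩, h4, h5⟩
      refine ⟨h1, h4, (ih ?_).1 h5⟩
      cases b <;> assumption
    · rintro ⟨h1, rfl, h5⟩
      have h2 := h.trans (reachable_of_arc h1)
      refine ⟨⟨h1, ?_⟩, rfl, (ih h2).2 h5⟩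
      cases b
      exacts [⟨h2, h⟩, ⟨h, h2⟩]

/-! ### Branchings have diforests as arc sets -/

theorem IsArborescence.isDirectedPath_concat {e : E} (hH : H.IsArborescence r) (he : e ∈ H.arcs)
    (hl : H.IsDirectedPath r l (D.tail e)) : H.IsDirectedPath r (l ++ [(e, true)]) (D.head e) := by
  obtain ⟨hw, hfwd, hnd⟩ := hl
  refine ⟨isWalk_concat.2 ⟨hw, he, rfl⟩, ?_, ?_⟩
  · intro d hd
    rcases List.mem_append.1 hd with hd | hd
    · exact hfwd d hd
    · rw [List.mem_singleton.1 hd]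
  · rw [List.map_append, ← List.cons_append]
    refine List.nodup_append'.2 ⟨hnd, by simp, ?_⟩
    simp only [List.map_cons, List.map_nil, target_true, List.disjoint_singleton]
    intro hmem
    -- the path from `r` to the tail of `e` would close a cycle through the head of `e`
    obtain ⟨p, q, rfl, hq, hdisj⟩ : ∃ p q, l = p ++ q ∧ H.IsWalk (D.head e) q (D.tail e) ∧
        D.head e ∉ q.map D.target := by
      rcases List.mem_cons.1 hmem with hr | hmem
      · exact ⟨[], l, rfl, hr ▸ hw, hr ▸ (List.nodup_cons.1 hnd).1⟩
      · obtain ⟨d, hd, hde⟩ := List.mem_map.1 hmem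
        obtain ⟨p, q, rfl⟩ := List.append_of_mem hd
        rw [show p ++ d :: q = (p ++ [d]) ++ q by simp] at hw hnd ⊢
        obtain ⟨x, hx, hq⟩ := isWalk_append.1 hw
        obtain rfl := (isWalk_concat.1 hx).2.2
        refine ⟨p ++ [d], q, rfl, hde ▸ hq, ?_⟩
        have := (List.nodup_cons.1 hnd).2
        rw [List.map_append] at this
        exact fun H' => (List.nodup_append'.1 this).2.2 (by simp [hde]) H'
    have hnd' : ((q ++ [(e, true)]).map D.target).Nodup := by
      have h1 := (List.nodup_cons.1 hnd).2
      rw [List.map_append] at h1 ⊢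
      refine List.nodup_append'.2 ⟨(List.nodup_append'.1 h1).2.1, by simp, ?_⟩
      simpa using hdisj
    refine hH.1.2.2 (D.head e) (q ++ [(e, true)])
      ⟨isWalk_concat.2 ⟨hq, he, rfl⟩, by simp, List.Nodup.of_map D.head ?_, hnd'⟩
    convert hnd' using 1
    rw [List.map_map]
    refine List.map_congr_left fun d hd => ?_
    have : d.2 = true := by
      rcases List.mem_append.1 hd with hd | hd
      · exact hfwd d (List.mem_append_right _ hd)
      · rw [List.mem_singleton.1 hd]
    simp [target, this]

/-- The unique path to the head of `e` is the path to its tail followed by `e`. Its last arc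
recovers `e`, and path length serves as rank. -/
theorem IsArborescence.isDiforest (hH : H.IsArborescence r) :
    IsDiforest D.tail D.head H.arcs := by
  have := hH.2.2
  choose! p hp huniq using this
  have key : ∀ e ∈ H.arcs, p (D.head e) = p (D.tail e) ++ [(e, true)] := fun e he =>
    (huniq _ (H.head_mem e he) _ (hH.isDirectedPath_concat he (hp _ (H.tail_mem e he)))).symm
  refine ⟨fun e he f hf hef => ?_, fun v => (p v).length, fun e he => ?_⟩
  · have h1 := key e he
    have h2 := key f hf
    rw [hef, h2] at h1
    have := List.append_inj_right' h1 rfl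
    simpa using this.symm
  · simp [key e he]

theorem IsBranching.isDiforest (hH : H.IsBranching) : IsDiforest D.tail D.head H.arcs := by
  have hC : ∀ C : D.Subdigraph, (∃ r, C.IsArborescence r) →
      ∃ rank : V → ℕ, ∀ e ∈ C.arcs, rank (D.tail e) < rank (D.head e) := fun C ⟨r, hr⟩ =>
    hr.isDiforest.2
  choose! rank hrank using hC
  have hmem : ∀ e ∈ H.arcs, e ∈ (H.component (D.head e)).arcs := fun e he =>
    ⟨he, reachable_of_arc (d := (e, false)) he, [], H.head_mem e he, rfl⟩
  refine ⟨fun e he f hf hef => ?_, fun v => rank (H.component v) v, fun e he => ?_⟩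
  · obtain ⟨r, hr⟩ := hH.2 (D.head e) (H.head_mem e he)
    exact hr.isDiforest.1 (hmem e he) (hef ▸ hmem f hf) hef
  · dsimp only
    rw [show H.component (D.tail e) = H.component (D.head e) from
      component_eq_of_reachable (reachable_of_arc (d := (e, true)) he)]
    exact hrank _ (hH.2 (D.head e) (H.head_mem e he)) e (hmem e he)

/-! ### Diforests are the arc sets of branchings -/

/-- A walk that traverses every arc forwards. -/
def IsForwardWalk (H : D.Subdigraph) (u : V) (l : List (E × Bool)) (v : V) : Prop :=
  H.IsWalk u l v ∧ ∀ d ∈ l, d.2 = true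

theorem isForwardWalk_concat : H.IsForwardWalk u (p ++ [d]) w ↔
    H.IsForwardWalk u p (D.tail d.1) ∧ d.1 ∈ H.arcs ∧ d.2 = true ∧ D.head d.1 = w := by
  obtain ⟨e, b⟩ := d
  simp only [IsForwardWalk, isWalk_concat, List.mem_append, List.mem_singleton]
  constructor
  · rintro ⟨⟨h1, h2, h3⟩, h4⟩
    obtain rfl : b = true := h4 (e, b) (Or.inr rfl)
    exact ⟨⟨h1, fun d hd => h4 d (Or.inl hd)⟩, h2, rfl, h3⟩
  · rintro ⟨⟨h1, h4⟩, h2, rfl, h3⟩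
    refine ⟨⟨h1, h2, h3⟩, ?_⟩
    rintro d (hd | rfl)
    exacts [h4 d hd, rfl]

theorem IsForwardWalk.rank_lt {rank : V → ℕ}
    (hrank : ∀ e ∈ H.arcs, rank (D.tail e) < rank (D.head e)) (h : H.IsForwardWalk u l v) :
    (∀ x ∈ l.map D.target, rank u < rank x) ∧ (u :: l.map D.target).Nodup := by
  induction l generalizing u with
  | nil => simp
  | cons d l ih =>
    obtain ⟨⟨h1, rfl, h2⟩, h3⟩ := h
    obtain ⟨e, b⟩ := d
    obtain rfl : b = true := h3 (e, b) (by simp)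
    have h4 := ih ⟨h2, fun d hd => h3 d (by simp [hd])⟩
    have h5 := hrank e h1
    simp only [target_true] at h4
    have h6 : ∀ x ∈ ((e, true) :: l).map D.target, rank (D.source (e, true)) < rank x := by
      intro x hx
      rcases List.mem_cons.1 hx with rfl | hx
      · exact h5
      · exact h5.trans (h4.1 x hx)
    exact ⟨h6, List.nodup_cons.2 ⟨fun hx => (h6 _ hx).false, h4.2⟩⟩

/-- Read from the end, each arc is determined by its head, and no arc leads back into `r`. -/
theorem IsForwardWalk.unique (hinj : Set.InjOn D.head H.arcs)
    (hr : ∀ e ∈ H.arcs, D.head e ≠ r) (hp : H.IsForwardWalk r p u) (hq : H.IsForwardWalk r q u) :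
    p = q := by
  induction p using List.reverseRecOn generalizing u q with
  | nil =>
    rcases List.eq_nil_or_concat' q with rfl | ⟨q, d, rfl⟩
    · rfl
    · obtain ⟨-, h1, -, h2⟩ := isForwardWalk_concat.1 hq
      exact absurd (h2.trans hp.1.2.symm) (hr _ h1)
  | append_singleton p d ih =>
    obtain ⟨h1, h2, h3, h4⟩ := isForwardWalk_concat.1 hp
    rcases List.eq_nil_or_concat' q with rfl | ⟨q, d', rfl⟩
    · exact absurd (h4.trans hq.1.2.symm) (hr _ h2)
    · obtain ⟨h1', h2', h3', h4'⟩ := isForwardWalk_concat.1 hq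
      have hd : d = d' := Prod.ext (hinj h2 h2' (h4.trans h4'.symm)) (h3.trans h3'.symm)
      subst hd
      rw [ih h1 h1']

/-- A forward step extends the walk from `r`; a backward step along `e` deletes its last arc, which
must be `e`. -/
theorem exists_forwardWalk_of_isWalk (hinj : Set.InjOn D.head H.arcs)
    (hr : ∀ e ∈ H.arcs, D.head e ≠ r) (hl : H.IsWalk u l v) (hp : ∃ p, H.IsForwardWalk r p u) :
    ∃ p, H.IsForwardWalk r p v := by
  induction l generalizing u with
  | nil => exact hl.2 ▸ hp
  | cons d l ih =>
    obtain ⟨h1, rfl, h2⟩ := hl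
    refine ih h2 ?_
    obtain ⟨p, hp⟩ := hp
    obtain ⟨e, _ | _⟩ := d
    · rcases List.eq_nil_or_concat' p with rfl | ⟨p, d', rfl⟩
      · exact absurd hp.1.2.symm (hr _ h1)
      · obtain ⟨h3, h4, -, h5⟩ := isForwardWalk_concat.1 hp
        have : d'.1 = e := hinj h4 h1 h5
        exact ⟨p, this ▸ h3⟩
    · exact ⟨p ++ [(e, true)], isForwardWalk_concat.2 ⟨hp, h1, rfl, rfl⟩⟩

theorem exists_root_forwardWalk {rank : V → ℕ}
    (hrank : ∀ e ∈ H.arcs, rank (D.tail e) < rank (D.head e)) (hv : v ∈ H.verts) :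
    ∃ r, (∀ e ∈ H.arcs, D.head e ≠ r) ∧ ∃ p, H.IsForwardWalk r p v := by
  induction hn : rank v using Nat.strong_induction_on generalizing v with
  | _ n ih =>
  by_cases hroot : ∀ e ∈ H.arcs, D.head e ≠ v
  · exact ⟨v, hroot, [], ⟨hv, rfl⟩, by simp⟩
  · push Not at hroot
    obtain ⟨e, he, rfl⟩ := hroot
    obtain ⟨r, hr, p, hp⟩ := ih _ (hn ▸ hrank e he) (H.tail_mem e he) rfl
    exact ⟨r, hr, p ++ [(e, true)], isForwardWalk_concat.2 ⟨hp, he, rfl, rfl⟩⟩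

/-- After a forward step, a backward step would use an arc with the same head, hence the same arc.
So a trail that starts forwards stays forwards. -/
theorem rank_lt_of_isWalk_of_forward {rank : V → ℕ} (hinj : Set.InjOn D.head H.arcs)
    (hrank : ∀ e ∈ H.arcs, rank (D.tail e) < rank (D.head e)) {e : E}
    (hl : H.IsWalk u ((e, true) :: l) v) (hnd : (((e, true) :: l).map Prod.fst).Nodup) :
    rank u < rank v ∧ ∃ f, (f, true) ∈ (e, true) :: l ∧ D.head f = v := by
  induction l generalizing u e with
  | nil =>
    obtain ⟨h1, rfl, -, rfl⟩ := hl
    exact ⟨hrank e h1, e, by simp⟩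
  | cons d l ih =>
    obtain ⟨h1, rfl, h2⟩ := hl
    obtain ⟨f, _ | _⟩ := d
    · have hef : f = e := hinj h2.1 h1 h2.2.1
      simp [hef] at hnd
    · obtain ⟨h3, g, hg, hgv⟩ := ih h2 (List.nodup_cons.1 hnd).2
      exact ⟨(hrank e h1).trans h3, g, List.mem_cons_of_mem _ hg, hgv⟩

theorem rank_lt_or_exists_forward_of_isWalk {rank : V → ℕ} (hinj : Set.InjOn D.head H.arcs)
    (hrank : ∀ e ∈ H.arcs, rank (D.tail e) < rank (D.head e))
    (hl : H.IsWalk u l v) (hne : l ≠ []) (hnd : (l.map Prod.fst).Nodup) :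
    rank v < rank u ∨ ∃ f, (f, true) ∈ l ∧ D.head f = v := by
  induction l generalizing u with
  | nil => exact absurd rfl hne
  | cons d l ih =>
    obtain ⟨e, _ | _⟩ := d
    · obtain ⟨h1, rfl, h2⟩ := hl
      rcases eq_or_ne l [] with rfl | hl'
      · obtain ⟨-, rfl⟩ := h2
        exact Or.inl (hrank e h1)
      · rcases ih h2 hl' (List.nodup_cons.1 hnd).2 with h3 | ⟨f, hf, hfv⟩
        · exact Or.inl (h3.trans (hrank e h1))
        · exact Or.inr ⟨f, List.mem_cons_of_mem _ hf, hfv⟩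
    · exact Or.inr (rank_lt_of_isWalk_of_forward hinj hrank hl hnd).2

/-- A trail is a run of backward steps followed by a run of forward ones. If it is closed, rank
rules out a single run, and with both runs the first and last arcs share the head `u`, so an arc
repeats. -/
theorem not_isCycle_of_isDiforest (hH : IsDiforest D.tail D.head H.arcs) : ¬ H.IsCycle u l := by
  rintro ⟨hw, hne, hnd, -⟩
  obtain ⟨hinj, rank, hrank⟩ := hH
  rcases l with - | ⟨⟨e, _ | _⟩, l⟩
  · exact hne rfl
  · rcases rank_lt_or_exists_forward_of_isWalk hinj hrank hw hne hnd with h | ⟨f, hf, hfu⟩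
    · exact h.false
    · have hf' : (f, true) ∈ l := by simpa using hf
      have hfe : f = e := by
        refine hinj ?_ hw.1 (hfu.trans hw.2.1.symm)
        obtain ⟨a, b, rfl⟩ := List.append_of_mem hf'
        obtain ⟨x, -, hx⟩ := isWalk_append.1 hw.2.2
        exact hx.1
      subst hfe
      exact (List.nodup_cons.1 hnd).1 (List.mem_map.2 ⟨_, hf', rfl⟩)
  · exact (rank_lt_of_isWalk_of_forward hinj hrank hw hnd).1.false

theorem component_isArborescence (hH : IsDiforest D.tail D.head H.arcs)
    (hr : ∀ e ∈ H.arcs, D.head e ≠ r) (hp : H.IsForwardWalk r p v) :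
    (H.component v).IsArborescence r := by
  obtain ⟨hinj, rank, hrank⟩ := hH
  have hrv : H.Reachable r v := ⟨p, hp.1⟩
  have hr' : H.Reachable r r := hrv.trans hrv.symm
  rw [← component_eq_of_reachable hrv]
  refine ⟨⟨⟨r, hp.1.left_mem, hr'⟩, ?_, ?_⟩, ⟨hp.1.left_mem, hr'⟩, ?_⟩
  · rintro u ⟨-, hu⟩ w ⟨-, hw⟩
    obtain ⟨l, hl⟩ := hu.symm.trans hw
    exact ⟨l, (isWalk_component_iff hu).2 hl⟩
  · refine fun u l => not_isCycle_of_isDiforest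
      (IsDiforest.mono ⟨hinj, rank, hrank⟩ fun e he => he.1)
  · rintro u ⟨-, l, hl⟩
    obtain ⟨q, hq⟩ := exists_forwardWalk_of_isWalk hinj hr hl
      ⟨[], ⟨hp.1.left_mem, rfl⟩, by simp⟩
    refine ⟨q, ⟨(isWalk_component_iff hr').2 hq.1, hq.2, (hq.rank_lt hrank).2⟩, ?_⟩
    rintro q' ⟨h1, h2, -⟩
    exact IsForwardWalk.unique hinj hr ⟨(isWalk_component_iff hr').1 h1, h2⟩ hq

theorem isBranching_of_isDiforest (hV : H.verts = Set.univ)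
    (hH : IsDiforest D.tail D.head H.arcs) : H.IsBranching := by
  refine ⟨hV, fun v hv => ?_⟩
  obtain ⟨r, hr, p, hp⟩ := exists_root_forwardWalk hH.2.choose_spec hv
  exact ⟨r, component_isArborescence hH hr hp⟩

theorem rootSet_eq_of_isDiforest (hV : H.verts = Set.univ)
    (hH : IsDiforest D.tail D.head H.arcs) : H.rootSet = (D.head '' H.arcs)ᶜ := by
  ext r
  simp only [rootSet, Set.mem_ofPred_eq, Set.mem_compl_iff, Set.mem_image, not_exists, not_and]
  constructor
  · rintro ⟨v, -, hv⟩ e he rfl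
    obtain ⟨rank, hrank⟩ := hH.2
    have hvr := hv.2.1.2
    have hvt := hvr.trans (reachable_of_arc (d := (e, false)) he)
    -- If an arc `e` entered the root, the directed path from the root to the tail of `e` would
    -- increase the rank, while `e` forces it to be lower at the tail.
    obtain ⟨l, ⟨hl, hfwd, -⟩, -⟩ := hv.2.2 (D.tail e) ⟨H.tail_mem e he, hvt⟩
    have hlt : ∀ x ∈ l.map D.target, rank (D.head e) < rank x := (IsForwardWalk.rank_lt hrank
      ⟨(isWalk_component_iff hvr).1 hl, hfwd⟩).1
    rcases List.eq_nil_or_concat' l with rfl | ⟨l, d, rfl⟩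
    · exact D.tail_ne_head e hl.2.symm
    · have h1 := (isWalk_concat.1 hl).2.2
      exact (hlt (D.tail e) (by simp [h1])).not_gt (hrank e he)
  · intro hr
    exact ⟨r, by simp [hV], component_isArborescence (p := []) hH hr ⟨⟨by simp [hV], rfl⟩, by simp⟩⟩

end Subdigraph

end MultiDigraph

/-! ### Partitioning into `k` diforests -/

section Existence

open Finset

variable {W F : Type*} [DecidableEq W] [Fintype W] [DecidableEq F] [Fintype F]

/-- Frank's characterization of the digraphs that can be partitioned into `k` branchings. -/
theorem exists_diforest_coloring (t h : F → W) (k : ℕ) (hdeg : ∀ v, #{e | h e = v} ≤ k)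
    (hsparse : ∀ U : Finset W, U.Nonempty → #{e | h e ∈ U ∧ t e ∈ U} + k ≤ k * #U) :
    ∃ f : F → Fin k, ∀ i, IsDiforest t h {e | f e = i} := by
  -- add a vertex `none` and `k - indegree v` arcs from it to each vertex `v`
  let t' : F ⊕ (Σ v : W, Fin (k - #{e | h e = v})) → Option W :=
    Sum.elim (fun e => some (t e)) fun _ => none
  let h' : F ⊕ (Σ v : W, Fin (k - #{e | h e = v})) → Option W :=
    Sum.elim (fun e => some (h e)) fun x => some x.1
  -- All in-degrees of original vertices are now `k`, so a set `X` of them is entered by `k * #X`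
  -- arcs minus those inside `X`, which is at least `k` by `hsparse`.
  have hcond : ∀ U : Finset (Option W), U.Nonempty →
      #(missedIndices (fun _ : Fin k => {none}) univ U) ≤ #(enteringArcs t' h' univ U) := by
    intro U hU
    by_cases hnone : none ∈ U
    · simp [missedIndices, hnone]
    let X : Finset W := univ.filter fun v => some v ∈ U
    have hXU : ∀ v, some v ∈ U ↔ v ∈ X := by simp [X]
    have hX : X.Nonempty := by
      obtain ⟨x | x, hx⟩ := hU
      exacts [absurd hx hnone, ⟨x, (hXU x).1 hx⟩]
    have hcount : #(enteringArcs t' h' univ U) =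
        #{e | h e ∈ X ∧ t e ∉ X} + ∑ v ∈ X, (k - #{e | h e = v}) := by
      rw [enteringArcs, card_filter, Fintype.sum_sum_type, Fintype.sum_sigma, card_filter]
      simp only [t', h', Sum.elim_inl, Sum.elim_inr, hXU, hnone, not_false_eq_true, and_true,
        sum_const, card_univ, Fintype.card_fin, smul_eq_mul]
      simp
    have h1 : ∑ v ∈ X, (k - #{e | h e = v}) + ∑ v ∈ X, #{e | h e = v} = k * #X := by
      rw [← sum_add_distrib, sum_congr rfl fun v _ => Nat.sub_add_cancel (hdeg v), sum_const,
        smul_eq_mul, mul_comm]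
    have h2 : ∑ v ∈ X, #{e | h e = v} = #{e | h e ∈ X} := by
      rw [card_eq_sum_card_fiberwise (t := X) (f := h) (fun e he => by simpa using he)]
      refine sum_congr rfl fun v hv => congrArg card ?_
      ext e
      simp only [mem_filter, mem_univ, true_and]
      exact ⟨fun H => ⟨H ▸ hv, H⟩, fun H => H.2⟩
    have h3 := card_filter_add_card_filter_not (s := univ.filter fun e => h e ∈ X)
      (fun e => t e ∈ X)
    rw [filter_filter, filter_filter] at h3
    have h4 := hsparse X hX
    have h5 : #(missedIndices (fun _ : Fin k => {none}) univ U) ≤ k :=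
      (card_le_univ _).trans (by simp)
    omega
  obtain ⟨B, -, hdisj, hB⟩ := exists_disjoint_diforests t' h' univ _ hcond
  -- The extended digraph has `k * |W|` arcs, and each of the `k` diforests uses `|W|` of them.
  have hunion : univ.biUnion B = univ := by
    refine eq_of_subset_of_card_le (subset_univ _) ?_
    rw [card_biUnion fun i _ j _ hij => hdisj i j hij]
    have hcardB : ∀ i, #(B i) = Fintype.card W := by
      intro i
      rw [← (hB i).1.card_image, (hB i).2, card_univ_sdiff, Fintype.card_option]
      simp
    have h1 : ∑ v : W, (k - #{e | h e = v}) + ∑ v, #{e | h e = v} = k * Fintype.card W := by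
      rw [← sum_add_distrib, sum_congr rfl fun v _ => Nat.sub_add_cancel (hdeg v), sum_const,
        smul_eq_mul, mul_comm, card_univ]
    have h2 : ∑ v, #{e | h e = v} = Fintype.card F :=
      (card_eq_sum_card_fiberwise (s := univ) (t := univ) (f := h) (by simp)).symm
    simp only [hcardB, sum_const, card_univ, Fintype.card_fin, smul_eq_mul, Fintype.card_sum,
      Fintype.card_sigma]
    omega
  have hcover : ∀ e : F, ∃ i, Sum.inl e ∈ B i := by
    intro e
    have := mem_univ (Sum.inl e : F ⊕ (Σ v : W, Fin (k - #{e | h e = v})))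
    rw [← hunion] at this
    simpa using this
  choose f hf using hcover
  refine ⟨f, fun i => ?_⟩
  have hsub : ∀ e, f e = i → Sum.inl e ∈ B i := fun e he => he ▸ hf e
  obtain ⟨⟨hinj, rank, hrank⟩, -⟩ := hB i
  refine ⟨fun e he e' he' hee' => ?_, fun v => rank (some v), fun e he => ?_⟩
  · exact Sum.inl_injective (hinj (hsub e he) (hsub e' he') (congrArg some hee'))
  · exact hrank _ (hsub e he)

end Existence

/-! ### Rounding, and assembly of the two statements -/

theorem eq_floor_or_eq_ceil_of_balanced {k : ℕ} (hk : 0 < k) (a : Fin k → ℤ)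
    (ha : ∀ i j, a i ≤ a j + 1) {c : ℤ} (hc : ∑ i, a i = c) (i : Fin k) :
    a i = ⌊(c : ℝ) / k⌋ ∨ a i = ⌈(c : ℝ) / k⌉ := by
  have hk' : (0 : ℝ) < k := by exact_mod_cast hk
  -- Summing `a j ≤ a i + 1` is strict because of the term `j = i`. With the lower bound, `a i` is
  -- within less than 1 of `c / k`.
  have hupper : c < k * (a i + 1) := by
    have := Finset.sum_lt_sum (s := Finset.univ) (f := a) (g := fun _ => a i + 1)
      (fun j _ => ha j i) ⟨i, Finset.mem_univ i, by simp⟩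
    simpa [hc] using this
  have hlower : k * (a i - 1) < c := by
    have := Finset.sum_lt_sum (s := Finset.univ) (f := fun _ => a i - 1) (g := a)
      (fun j _ => by linarith [ha i j]) ⟨i, Finset.mem_univ i, by simp⟩
    simpa [hc, mul_sub] using this
  have hupper' : (c : ℝ) < k * (a i + 1) := by exact_mod_cast hupper
  have hlower' : (k : ℝ) * (a i - 1) < c := by exact_mod_cast hlower
  rcases le_total ((a i : ℝ) * k) c with h | h
  · left
    rw [eq_comm, Int.floor_eq_iff, le_div_iff₀ hk', div_lt_iff₀ hk']
    exact ⟨h, by linarith⟩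
  · right
    rw [eq_comm, Int.ceil_eq_iff, lt_div_iff₀ hk', div_le_iff₀ hk']
    exact ⟨by linarith, h⟩

namespace MultiDigraph

variable {V E : Type*} {D : MultiDigraph V E}

theorem Subdigraph.ncard_rootSet_add_size [Finite V] {H : D.Subdigraph} (hV : H.verts = Set.univ)
    (hH : IsDiforest D.tail D.head H.arcs) : H.rootSet.ncard + H.size = Nat.card V := by
  rw [rootSet_eq_of_isDiforest hV hH, size, ← Set.InjOn.ncard_image hH.1, add_comm,
    Set.ncard_add_ncard_compl]

theorem exists_balanced_decomposition [Finite V] [Finite E] {k : ℕ} (f : E → Fin k)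
    (hf : ∀ i, IsDiforest D.tail D.head {e | f e = i}) :
    ∃ B : Fin k → D.Subdigraph, D.IsBranchingDecomposition B ∧
      (∀ i j, (B i).size ≤ (B j).size + 1) ∧ ∑ i, (B i).size = Nat.card E ∧
      ∀ i, (B i).rootSet.ncard + (B i).size = Nat.card V := by
  classical
  have := Fintype.ofFinite V
  have := Fintype.ofFinite E
  obtain ⟨g, hg, hbal⟩ := exists_balanced_coloring f hf
  let B : Fin k → D.Subdigraph := fun i => ⟨Set.univ, {e | g e = i}, by simp, by simp⟩
  have hsize : ∀ i, (B i).size = (Finset.univ.filter fun e => g e = i).card := fun i => by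
    rw [← Set.ncard_coe_finset, Finset.coe_filter_univ]; rfl
  refine ⟨B, ⟨⟨fun i => Subdigraph.isBranching_of_isDiforest rfl (hg i), fun e => ⟨g e, rfl⟩⟩, ?_⟩,
    ?_, ?_, fun i => Subdigraph.ncard_rootSet_add_size rfl (hg i)⟩
  · intro i j hij
    exact Set.disjoint_left.2 fun e (he : g e = i) (he' : g e = j) => hij (he.symm.trans he')
  · simpa only [hsize] using hbal
  · simp only [hsize, Nat.card_eq_fintype_card]
    exact (Finset.card_eq_sum_card_fiberwise (s := Finset.univ) (t := Finset.univ) (f := g)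
      (by simp)).symm

theorem inDegree_le_maxInDegree [Finite V] (D : MultiDigraph V E) (v : V) :
    D.inDegree v ≤ D.maxInDegree :=
  le_ciSup (f := D.inDegree) (Set.finite_range _).bddAbove v

theorem ncard_arcs_add_le_of_fractionalArboricity_le [Finite E] {k : ℕ}
    (hD : D.fractionalArboricity ≤ k) (H : D.Subdigraph) (hH : 2 ≤ H.verts.ncard) :
    H.arcs.ncard + k ≤ k * H.verts.ncard := by
  -- Needed because `sSup` of an unbounded set of reals is 0. The denominators are at least 1, so
  -- `|E|` is a bound.
  have hbdd : BddAbove {q | ∃ H : D.Subdigraph, 2 ≤ H.verts.ncard ∧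
      q = (H.arcs.ncard : ℝ) / ((H.verts.ncard : ℝ) - 1)} := by
    refine ⟨Nat.card E, ?_⟩
    rintro q ⟨H, hH, rfl⟩
    have h1 : (2 : ℝ) ≤ H.verts.ncard := by exact_mod_cast hH
    refine (div_le_self (by positivity) (by linarith)).trans ?_
    exact_mod_cast Set.ncard_le_card H.arcs
  have h1 : (2 : ℝ) ≤ H.verts.ncard := by exact_mod_cast hH
  have h2 := (le_csSup hbdd ⟨H, hH, rfl⟩).trans hD
  rw [div_le_iff₀ (by linarith)] at h2
  have h3 : (H.arcs.ncard : ℝ) + k ≤ k * H.verts.ncard := by linarith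
  exact_mod_cast h3

theorem exists_diforest_coloring_of_le [Finite V] [Finite E] {k : ℕ} (hdeg : D.maxInDegree ≤ k)
    (harb : D.fractionalArboricity ≤ k) :
    ∃ f : E → Fin k, ∀ i, IsDiforest D.tail D.head {e | f e = i} := by
  classical
  have := Fintype.ofFinite V
  have := Fintype.ofFinite E
  refine exists_diforest_coloring D.tail D.head k (fun v => ?_) fun U hU => ?_
  · refine le_trans (le_of_eq ?_) ((D.inDegree_le_maxInDegree v).trans hdeg)
    rw [inDegree, ← Set.ncard_coe_finset, Finset.coe_filter_univ]
  -- Singletons are not covered by the fractional arboricity; there the absence of loops suffices.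
  · obtain h1 | h1 : U.card = 1 ∨ 2 ≤ U.card := by have := hU.card_pos; omega
    · obtain ⟨v, rfl⟩ := Finset.card_eq_one.1 h1
      have : ∀ e, ¬ (D.head e = v ∧ D.tail e = v) := fun e he =>
        D.tail_ne_head e (he.2.trans he.1.symm)
      simp [this]
    · have := ncard_arcs_add_le_of_fractionalArboricity_le harb
        ⟨U, {e | D.head e ∈ U ∧ D.tail e ∈ U}, fun e he => he.2, fun e he => he.1⟩
        (by simpa using h1)
      simp only [Set.ncard_coe_finset] at this
      rwa [← Finset.coe_filter_univ, Set.ncard_coe_finset] at this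

theorem IsBranchingCover.exists_diforest_coloring {k : ℕ} {B : Fin k → D.Subdigraph}
    (hB : D.IsBranchingCover B) :
    ∃ f : E → Fin k, ∀ i, IsDiforest D.tail D.head {e | f e = i} := by
  choose f hf using hB.2
  exact ⟨f, fun i => (hB.1 i).isDiforest.mono fun e (he : f e = i) => he ▸ hf e⟩

end MultiDigraph

theorem corollary1p7 {V E : Type*} [Finite V] [Finite E] (D : MultiDigraph V E)
    (k : ℕ) (hk : 0 < k) :
    ((∃ B : Fin k → D.Subdigraph, D.IsBranchingCover B) →
      ∃ B : Fin k → D.Subdigraph, D.IsBranchingCover B ∧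
        ∀ i, (B i).size = ⌊(Nat.card E : ℝ) / k⌋₊ ∨ (B i).size = ⌈(Nat.card E : ℝ) / k⌉₊) ∧
    (D.maxInDegree ≤ k → D.fractionalArboricity ≤ k →
      ∀ c : ℤ, c = (k : ℤ) * Nat.card V - Nat.card E →
        ∃ B : Fin k → D.Subdigraph, D.IsBranchingDecomposition B ∧
          ∀ i, ((B i).rootSet.ncard : ℤ) = ⌊(c : ℝ) / k⌋ ∨
            ((B i).rootSet.ncard : ℤ) = ⌈(c : ℝ) / k⌉) := by
  constructor
  · rintro ⟨B₀, hB₀⟩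
    obtain ⟨f, hf⟩ := hB₀.exists_diforest_coloring
    obtain ⟨B, hB, hbal, hsum, -⟩ := MultiDigraph.exists_balanced_decomposition f hf
    refine ⟨B, hB.1, fun i => ?_⟩
    have := eq_floor_or_eq_ceil_of_balanced hk (fun i => ((B i).size : ℤ))
      (fun i j => by exact_mod_cast hbal i j) (c := Nat.card E) (by exact_mod_cast hsum) i
    rw [Int.cast_natCast, ← Int.natCast_floor_eq_floor (by positivity),
      ← Int.natCast_ceil_eq_ceil (by positivity)] at this
    exact_mod_cast this
  · rintro hdeg harb c rfl
    obtain ⟨f, hf⟩ := MultiDigraph.exists_diforest_coloring_of_le hdeg harb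
    obtain ⟨B, hB, hbal, hsum, hroot⟩ := MultiDigraph.exists_balanced_decomposition f hf
    refine ⟨B, hB, eq_floor_or_eq_ceil_of_balanced hk (fun i => ((B i).rootSet.ncard : ℤ))
      (fun i j => ?_) ?_⟩
    · have := hroot i
      have := hroot j
      have := hbal j i
      omega
    · have h1 : ∀ i, ((B i).rootSet.ncard : ℤ) = Nat.card V - (B i).size := fun i => by
        have := hroot i
        omega
      simp only [h1, Finset.sum_sub_distrib, Finset.sum_const, Finset.card_univ, Fintype.card_fin,
        nsmul_eq_mul, ← hsum, Nat.cast_sum]
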